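/- For a positive integer $m$, call a set of $m$ distinct nonzero rational numbers a strong rational $D(-1)$-$m$-tuple if $xy-1$ is the square of a rational number for all elements $x,y$ of the set, including the case $x=y$ (so $x^2-1$ is also required to be a square; $0$ counts as a square). For $m=2$ and $m=3$ it is called a strong rational $D(-1)$-pair and a strong rational $D(-1)$-triple, respectively. Let $b\in\mathbb{Q}$ be such that $\{1,b\}$ is a strong rational $D(-1)$-pair. Then there exist infinitely many $c\in\mathbb{Q}$ such that $\{1,b,c\}$ is a strong rational $D(-1)$-triple. -/

import Mathlib

/-- A strong rational `D(q)`-`m`-tuple: a set of `m` distinct nonzero rationals such that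
`x * y + q` is the square of a rational for all elements `x`, `y` of the set, the case `x = y`
included. -/
def IsStrongRationalDTuple (q : ℚ) (m : ℕ) (S : Finset ℚ) : Prop :=
  S.card = m ∧ 0 ∉ S ∧ ∀ x ∈ S, ∀ y ∈ S, IsSquare (x * y + q)

open WeierstrassCurve.Affine

/-! ### Sums of points and squares -/

/-! Put `c = x / b`. Then `c` extends `{1, b}` when `x - 1`, `b(x - b)`, `b(x + b)` are squares and
`c ≠ 1, b`; such `x` are abscissae on `y² = (x - 1)(x - b)(x + b)`. The value `c = b` gives the
point `P = (b², b(b² - 1))`. Adding a doubled point preserves the three square conditions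
(`IsExtensionPoint.add_double`), so every odd multiple of `P` satisfies them. `P` has infinite
order: `b ± 1` are squares differing by 2, which forces `|b|₂ > 1`, and each doubling then
multiplies `|x|₂` by 4. -/

lemma IsSquare.mul_of_mul_mul {F : Type*} [Field F] {d u v w : F} (hu : u ≠ 0) (hv : v ≠ 0) (hdu : IsSquare (d * u))
    (hsv : IsSquare v) (h : IsSquare (u * v * w)) : IsSquare (d * w) := by
  have : d * w = d * u * v * (u * v * w) / (u * v) ^ 2 := by field_simp
  rw [this]
  exact ((hdu.mul hsv).mul h).div (IsSquare.sq _)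

section Chord

variable {F : Type*} [Field F] [DecidableEq F] {W : WeierstrassCurve.Affine F}

/-- On `y² = f(x)`, the abscissae of `P`, `Q` and `P + Q`, measured from a root of `f`,
multiply to a square. -/
lemma isSquare_mul_addX_sub (h₁ : W.a₁ = 0) (h₃ : W.a₃ = 0) {x₁ y₁ x₂ y₂ e : F}
    (hP : W.Equation x₁ y₁) (hQ : W.Equation x₂ y₂) (hxy : ¬(x₁ = x₂ ∧ y₁ = W.negY x₂ y₂))
    (he : W.Equation e 0) :
    IsSquare ((x₁ - e) * (x₂ - e) * (W.addX x₁ x₂ (W.slope x₁ x₂ y₁ y₂) - e)) := by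
  -- The chord or tangent `ℓ` satisfies `f - ℓ² = ∏ (X - xᵢ)`; at a root `e` of `f` this leaves `∏
  -- (xᵢ - e) = ℓ(e)²`.
  have key := congrArg (Polynomial.eval e) (addPolynomial_slope hP hQ hxy)
  rw [addPolynomial_eq] at key
  simp only [Cubic.toPoly, Polynomial.eval_neg, Polynomial.eval_add, Polynomial.eval_mul,
    Polynomial.eval_C, Polynomial.eval_pow, Polynomial.eval_X, Polynomial.eval_sub, h₁, h₃] at key
  rw [equation_iff] at he
  refine ⟨W.slope x₁ x₂ y₁ y₂ * (e - x₁) + y₁, ?_⟩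
  linear_combination he - key

lemma exists_add_eq_some (h₁ : W.a₁ = 0) (h₃ : W.a₃ = 0) {x₁ y₁ x₂ y₂ : F}
    (hP : W.Nonsingular x₁ y₁) (hQ : W.Nonsingular x₂ y₂)
    (h : Point.some x₁ y₁ hP + Point.some x₂ y₂ hQ ≠ 0) :
    ∃ x y, ∃ hR : W.Nonsingular x y, Point.some x₁ y₁ hP + Point.some x₂ y₂ hQ = .some x y hR ∧
      ∀ e, W.Equation e 0 → IsSquare ((x₁ - e) * (x₂ - e) * (x - e)) := by
  have hxy : ¬(x₁ = x₂ ∧ y₁ = W.negY x₂ y₂) := fun H ↦ h (Point.add_of_Y_eq H.1 H.2)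
  exact ⟨_, _, _, Point.add_some hxy, fun e he ↦ isSquare_mul_addX_sub h₁ h₃ hP.1 hQ.1 hxy he⟩

lemma x_ne_of_add_self_ne_zero (h₁ : W.a₁ = 0) (h₃ : W.a₃ = 0) {x y e : F}
    (hP : W.Nonsingular x y) (h : Point.some x y hP + Point.some x y hP ≠ 0)
    (he : W.Equation e 0) : x - e ≠ 0 := by
  intro hxe
  obtain rfl := sub_eq_zero.mp hxe
  refine h (Point.add_self_of_Y_eq ?_)
  have hy := hP.1
  rw [equation_iff] at hy he
  have : y ^ 2 = 0 := by simp only [h₁, h₃] at hy he; linear_combination hy - he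
  simp [negY, h₁, h₃, pow_eq_zero_iff two_ne_zero |>.mp this]

end Chord

/-! ### The 2-adic norm on rationals -/

lemma padic_norm_add_of_lt {x y : ℚ_[2]} (h : ‖y‖ < ‖x‖) : ‖x + y‖ = ‖x‖ := by
  rw [Padic.add_eq_max_of_ne h.ne', max_eq_left h.le]

/-- No two 2-adic integers have squares differing by `2`. -/
lemma one_lt_padic_norm_of_sq_sub_sq {r s : ℚ_[2]} (h : s ^ 2 - r ^ 2 = 2) : 1 < ‖r‖ := by
  by_contra! hr
  have hs : ‖s‖ ≤ 1 := by
    have h2 : ‖s ^ 2‖ ≤ 1 := by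
      rw [show s ^ 2 = r ^ 2 + 2 by linear_combination h]
      refine (Padic.nonarchimedean _ _).trans (max_le ?_ (Padic.norm_int_le_one 2))
      rw [norm_pow]
      exact pow_le_one₀ (norm_nonneg _) hr
    rw [norm_pow] at h2
    exact (pow_le_one_iff_of_nonneg (norm_nonneg _) two_ne_zero).mp h2
  obtain ⟨s', rfl⟩ : ∃ s' : ℤ_[2], (s' : ℚ_[2]) = s := ⟨⟨s, hs⟩, rfl⟩
  obtain ⟨r', rfl⟩ : ∃ r' : ℤ_[2], (r' : ℚ_[2]) = r := ⟨⟨r, hr⟩, rfl⟩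
  have hz : s' ^ 2 - r' ^ 2 = 2 := PadicInt.ext (by push_cast; exact h)
  -- Squares mod 4 are 0 or 1, so they never differ by 2.
  have hm := congrArg (PadicInt.toZModPow 2) hz
  simp only [map_sub, map_pow, map_ofNat] at hm
  generalize PadicInt.toZModPow 2 s' = a at hm
  generalize PadicInt.toZModPow 2 r' = c at hm
  clear hz h hs hr s' r'
  revert a c
  decide

/-! ### The curve of extensions of `{1, b}` -/

/-- The curve `y² = (x - 1)(x - b)(x + b)`. -/
def extensionCurve (b : ℚ) : WeierstrassCurve.Affine ℚ := ⟨0, -1, 0, -b ^ 2, b ^ 2⟩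

section ExtensionCurve

variable {b : ℚ}

lemma extensionCurve_equation_iff {x y : ℚ} :
    (extensionCurve b).Equation x y ↔ y ^ 2 = (x - 1) * (x - b) * (x + b) := by
  rw [equation_iff]
  simp only [extensionCurve]
  constructor <;> intro h <;> linear_combination h

lemma extensionCurve_nonsingular {x y : ℚ} (h : y ^ 2 = (x - 1) * (x - b) * (x + b))
    (hy : y ≠ 0) : (extensionCurve b).Nonsingular x y := by
  rw [nonsingular_iff']
  refine ⟨extensionCurve_equation_iff.mpr h, Or.inr ?_⟩
  simpa [extensionCurve] using hy

lemma extensionCurve_exists_double (hb : 1 < ‖(b : ℚ_[2])‖) {x y : ℚ}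
    (h : (extensionCurve b).Nonsingular x y) (hx : ‖(b : ℚ_[2])‖ < ‖(x : ℚ_[2])‖) :
    ∃ x' y', ∃ h' : (extensionCurve b).Nonsingular x' y',
      Point.some x y h + Point.some x y h = .some x' y' h' ∧
        ‖(x' : ℚ_[2])‖ = 4 * ‖(x : ℚ_[2])‖ := by
  have heq := extensionCurve_equation_iff.mp h.1
  have hx0 : 0 < ‖(x : ℚ_[2])‖ := (norm_nonneg _).trans_lt hx
  have hyn : ‖(y : ℚ_[2])‖ ^ 2 = ‖(x : ℚ_[2])‖ ^ 3 := by
    have hc : (y : ℚ_[2]) ^ 2 = (x + -1) * (x + -b) * (x + b) := by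
      have := congrArg (Rat.cast : ℚ → ℚ_[2]) heq
      push_cast at this
      linear_combination this
    rw [← norm_pow, hc, norm_mul, norm_mul, padic_norm_add_of_lt (by simpa using hb.trans hx),
      padic_norm_add_of_lt (by simpa using hx), padic_norm_add_of_lt hx]
    ring
  have hy0 : y ≠ 0 := by
    rintro rfl
    have := pow_pos hx0 3
    rw [← hyn] at this
    simp at this
  have hyne : y ≠ (extensionCurve b).negY x y := by
    intro H
    simp only [negY, extensionCurve] at H
    exact hy0 (by linarith)
  refine ⟨_, _, _, Point.add_self_of_Y_ne hyne, ?_⟩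
  have hslope : (extensionCurve b).slope x x y y = (3 * x ^ 2 - 2 * x - b ^ 2) / (2 * y) := by
    rw [slope_of_Y_ne rfl hyne]
    simp only [negY, extensionCurve]
    congr 1 <;> ring
  set x' := (extensionCurve b).addX x x ((extensionCurve b).slope x x y y) with hx'
  -- Duplication formula relative to the root 1. The term `x²` dominates the right side 2-adically,
  -- and `|4|₂ = 1/4` supplies the factor 4.
  have hdouble : (x' - 1) * (4 * y ^ 2) = (x ^ 2 + (-2 * x + b ^ 2)) ^ 2 := by
    rw [hx', hslope]
    simp only [addX, extensionCurve]
    field_simp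
    rw [heq]
    ring
  have hnum : ‖(x : ℚ_[2]) ^ 2 + (-2 * x + b ^ 2)‖ = ‖(x : ℚ_[2])‖ ^ 2 := by
    rw [← norm_pow]
    refine padic_norm_add_of_lt ((Padic.nonarchimedean _ _).trans_lt (max_lt ?_ ?_))
    · have h2 : ‖(-2 : ℚ_[2])‖ ≤ 1 := by exact_mod_cast Padic.norm_int_le_one (p := 2) (-2)
      rw [norm_mul, norm_pow]
      nlinarith
    · rw [norm_pow, norm_pow]
      gcongr
  have h4 : ‖(4 : ℚ_[2])‖ = 1 / 4 := by
    rw [show (4 : ℚ_[2]) = (2 : ℕ) ^ 2 by norm_num, norm_pow, Padic.norm_p]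
    norm_num
  have hsub : ‖(x' : ℚ_[2]) - 1‖ = 4 * ‖(x : ℚ_[2])‖ := by
    have hc := congrArg (fun q : ℚ ↦ ‖(q : ℚ_[2])‖) hdouble
    simp only [Rat.cast_mul, Rat.cast_pow, Rat.cast_add, Rat.cast_sub, Rat.cast_one,
      Rat.cast_neg, Rat.cast_ofNat] at hc
    rw [norm_mul, norm_mul, norm_pow, norm_pow, hnum, hyn, h4] at hc
    have h3 := pow_pos hx0 3
    refine mul_right_cancel₀ h3.ne' ?_
    linear_combination 4 * hc
  have hlt : ‖(1 : ℚ_[2])‖ < ‖(x' : ℚ_[2]) - 1‖ := by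
    rw [hsub, norm_one]
    linarith
  have := padic_norm_add_of_lt hlt
  rwa [sub_add_cancel, hsub] at this

lemma extensionCurve_two_pow_nsmul (hb : 1 < ‖(b : ℚ_[2])‖) {x y : ℚ}
    (h : (extensionCurve b).Nonsingular x y) (hx : ‖(b : ℚ_[2])‖ < ‖(x : ℚ_[2])‖) (n : ℕ) :
    ∃ x' y', ∃ h' : (extensionCurve b).Nonsingular x' y',
      2 ^ n • Point.some x y h = .some x' y' h' ∧
        ‖(x' : ℚ_[2])‖ = 4 ^ n * ‖(x : ℚ_[2])‖ := by
  induction n with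
  | zero => exact ⟨x, y, h, by simp, by simp⟩
  | succ n ih =>
    obtain ⟨x₁, y₁, h₁, hP, hn⟩ := ih
    have hx₁ : ‖(b : ℚ_[2])‖ < ‖(x₁ : ℚ_[2])‖ := by
      rw [hn]
      have : (1 : ℝ) ≤ 4 ^ n := one_le_pow₀ (by norm_num)
      nlinarith
    obtain ⟨x₂, y₂, h₂, hP₂, hn₂⟩ := extensionCurve_exists_double hb h₁ hx₁
    exact ⟨x₂, y₂, h₂, by rw [pow_succ, mul_nsmul, hP, two_nsmul, hP₂], by
      rw [hn₂, hn]; ring⟩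

lemma extensionCurve_nsmul_ne_zero (hb : 1 < ‖(b : ℚ_[2])‖) {x y : ℚ}
    (h : (extensionCurve b).Nonsingular x y) (hx : ‖(b : ℚ_[2])‖ < ‖(x : ℚ_[2])‖) {k : ℕ}
    (hk : k ≠ 0) : k • Point.some x y h ≠ 0 := by
  intro h0
  have hfin : IsOfFinAddOrder (Point.some x y h) :=
    isOfFinAddOrder_iff_nsmul_eq_zero.mpr ⟨k, Nat.pos_of_ne_zero hk, h0⟩
  have hinj : Function.Injective fun n : ℕ ↦ 2 ^ n • Point.some x y h := by
    intro m n hmn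
    obtain ⟨x₁, y₁, h₁, hP₁, hn₁⟩ := extensionCurve_two_pow_nsmul hb h hx m
    obtain ⟨x₂, y₂, h₂, hP₂, hn₂⟩ := extensionCurve_two_pow_nsmul hb h hx n
    simp only [hP₁, hP₂, Point.some.injEq] at hmn
    rw [hmn.1, hn₂] at hn₁
    have hx0 : ‖(x : ℚ_[2])‖ ≠ 0 := ((norm_nonneg _).trans_lt hx).ne'
    exact (pow_right_injective₀ (by norm_num) (by norm_num) (mul_right_cancel₀ hx0 hn₁)).symm
  refine Set.infinite_of_injective_forall_mem hinj (fun n ↦ ?_)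
    (hfin.finite_multiples : (AddSubmonoid.multiples (Point.some x y h) : Set _).Finite)
  exact ⟨2 ^ n, rfl⟩

/-- The points `(x, y)` for which `x / b` extends `{1, b}`. -/
def IsExtensionPoint (b : ℚ) (P : (extensionCurve b).Point) : Prop :=
  ∃ x y, ∃ h : (extensionCurve b).Nonsingular x y, P = .some x y h ∧
    IsSquare (x - 1) ∧ IsSquare (b * (x - b)) ∧ IsSquare (b * (x + b))

/-- For each root `e`, the abscissa of `Q + Q` minus `e` is a square, so adding `Q + Q` keeps the
square class of `x - e`. The nonvanishing hypotheses keep the points affine and `x - e` nonzero. -/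
lemma IsExtensionPoint.add_double {P Q : (extensionCurve b).Point} (hP : IsExtensionPoint b P)
    (hPP : P + P ≠ 0) (hQ : Q + Q ≠ 0) (hQQ : (Q + Q) + (Q + Q) ≠ 0)
    (hPQ : P + (Q + Q) ≠ 0) : IsExtensionPoint b (P + (Q + Q)) := by
  obtain ⟨x₁, y₁, h₁, rfl, hs⟩ := hP
  have e₁ : (extensionCurve b).Equation 1 0 := by simp [extensionCurve_equation_iff]
  have e₂ : (extensionCurve b).Equation b 0 := by simp [extensionCurve_equation_iff]
  have e₃ : (extensionCurve b).Equation (-b) 0 := by simp [extensionCurve_equation_iff]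
  rcases Q with _ | ⟨x₂, y₂, h₂⟩
  · exact absurd (add_zero (0 : (extensionCurve b).Point)) hQ
  obtain ⟨x₃, y₃, h₃, hd, hds⟩ := exists_add_eq_some rfl rfl h₂ h₂ hQ
  rw [hd] at hQQ hPQ ⊢
  obtain ⟨x₄, y₄, h₄, ha, has⟩ := exists_add_eq_some rfl rfl h₁ h₃ hPQ
  have key (e d : ℚ) (he : (extensionCurve b).Equation e 0) (hsq : IsSquare (d * (x₁ - e))) :
      IsSquare (d * (x₄ - e)) := by
    have n₁ := x_ne_of_add_self_ne_zero rfl rfl h₁ hPP he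
    have n₂ := x_ne_of_add_self_ne_zero rfl rfl h₂ hQ he
    have n₃ := x_ne_of_add_self_ne_zero rfl rfl h₃ hQQ he
    have hsq₃ : IsSquare (x₃ - e) := by
      have := (hds e he).div (IsSquare.mul_self (x₂ - e))
      rwa [mul_div_cancel_left₀ _ (mul_ne_zero n₂ n₂)] at this
    exact hsq.mul_of_mul_mul n₁ n₃ hsq₃ (has e he)
  refine ⟨x₄, y₄, h₄, ha, ?_, key b b e₂ hs.2.1, ?_⟩
  · simpa using key 1 1 e₁ (by simpa using hs.1)
  · simpa using key (-b) b e₃ (by simpa using hs.2.2)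

end ExtensionCurve

/-! ### From extension points to triples -/

lemma isStrongRationalDTuple_of_isSquare {b c : ℚ} (hb1 : b ≠ 1) (hb0 : b ≠ 0)
    (hb : IsSquare (b - 1)) (hbb : IsSquare (b + 1)) (hc1 : c ≠ 1) (hcb : c ≠ b)
    (h₁ : IsSquare (c - 1)) (h₂ : IsSquare (c + 1)) (h₃ : IsSquare (b * c - 1)) :
    IsStrongRationalDTuple (-1) 3 {1, b, c} := by
  have hc0 : c ≠ 0 := by
    rintro rfl
    have := h₁.nonneg
    norm_num at this
  have hbs : IsSquare (b * b - 1) := by convert! hb.mul hbb using 1; ring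
  have hcs : IsSquare (c * c - 1) := by convert! h₁.mul h₂ using 1; ring
  have h₃' : IsSquare (c * b - 1) := by rwa [mul_comm]
  refine ⟨Finset.card_eq_three.mpr ⟨1, b, c, hb1.symm, hc1.symm, hcb.symm, rfl⟩, ?_, ?_⟩
  · simp [hb0.symm, hc0.symm]
  · simp only [Finset.mem_insert, Finset.mem_singleton, ← sub_eq_add_neg]
    rintro x (rfl | rfl | rfl) y (rfl | rfl | rfl) <;> simp_all

lemma IsStrongRationalDTuple.pair {b : ℚ} (hb : IsStrongRationalDTuple (-1) 2 {1, b}) :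
    b ≠ 1 ∧ b ≠ 0 ∧ IsSquare (b - 1) ∧ IsSquare (b + 1) := by
  obtain ⟨hcard, h0, hsq⟩ := hb
  have hb1 : b ≠ 1 := by
    rintro rfl
    simp at hcard
  have h₁ : IsSquare (b - 1) := by simpa [sub_eq_add_neg] using hsq b (by simp) 1 (by simp)
  have h₂ := (hsq b (by simp) b (by simp)).div h₁
  rw [show b * b + -1 = (b - 1) * (b + 1) by ring,
    mul_div_cancel_left₀ _ (sub_ne_zero.mpr hb1)] at h₂
  exact ⟨hb1, fun h ↦ h0 (by simp [h]), h₁, h₂⟩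

lemma one_lt_padic_norm_of_isSquare {b : ℚ} (h₁ : IsSquare (b - 1)) (h₂ : IsSquare (b + 1)) :
    1 < ‖(b : ℚ_[2])‖ := by
  obtain ⟨r, hr⟩ := h₁
  obtain ⟨s, hs⟩ := h₂
  have hrs : (s : ℚ_[2]) ^ 2 - (r : ℚ_[2]) ^ 2 = 2 := by
    have : s ^ 2 - r ^ 2 = 2 := by linear_combination hr - hs
    exact_mod_cast this
  have hlt := one_lt_padic_norm_of_sq_sub_sq hrs
  have hbr : (b : ℚ_[2]) = r ^ 2 + 1 := by
    have : b = r ^ 2 + 1 := by linear_combination hr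
    exact_mod_cast this
  have hlt2 : 1 < ‖(r : ℚ_[2]) ^ 2‖ := by
    rw [norm_pow]
    exact one_lt_pow₀ hlt two_ne_zero
  rw [hbr, padic_norm_add_of_lt (by simpa using hlt2)]
  exact hlt2

theorem proposition2 (b : ℚ) (hb : IsStrongRationalDTuple (-1) 2 {1, b}) :
    {c : ℚ | IsStrongRationalDTuple (-1) 3 {1, b, c}}.Infinite := by
  obtain ⟨hb1, hb0, hs₁, hs₂⟩ := hb.pair
  have hnorm := one_lt_padic_norm_of_isSquare hs₁ hs₂
  have hbp : b + 1 ≠ 0 := by linarith [hs₁.nonneg]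
  have hy : b * (b ^ 2 - 1) ≠ 0 := by
    rw [show b ^ 2 - 1 = (b - 1) * (b + 1) by ring]
    exact mul_ne_zero hb0 (mul_ne_zero (sub_ne_zero.mpr hb1) hbp)
  have hns : (extensionCurve b).Nonsingular (b ^ 2) (b * (b ^ 2 - 1)) :=
    extensionCurve_nonsingular (by ring) hy
  set P : (extensionCurve b).Point := .some _ _ hns with hP
  have hne (k : ℕ) (hk : k ≠ 0) : k • P ≠ 0 := by
    refine extensionCurve_nsmul_ne_zero hnorm hns ?_ hk
    rw [Rat.cast_pow, norm_pow]
    nlinarith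
  have hext (k : ℕ) : IsExtensionPoint b ((2 * k + 1) • P) := by
    induction k with
    | zero =>
      refine ⟨b ^ 2, _, hns, by simp [hP], ?_, ?_, ?_⟩
      · convert! hs₁.mul hs₂ using 1; ring
      · convert! (IsSquare.mul_self b).mul hs₁ using 1; ring
      · convert! (IsSquare.mul_self b).mul hs₂ using 1; ring
    | succ k ih =>
      have hstep : (2 * (k + 1) + 1) • P = (2 * k + 1) • P + (P + P) := by
        rw [← two_nsmul, ← add_nsmul]; congr 1
      rw [hstep]
      refine ih.add_double ?_ ?_ ?_ ?_
      · rw [← add_nsmul]; exact hne _ (by omega)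
      · rw [← two_nsmul]; exact hne _ (by omega)
      · rw [← two_nsmul, ← two_nsmul, ← mul_nsmul]; exact hne _ (by omega)
      · rw [← hstep]; exact hne _ (by omega)
  choose x y h hx hsq using hext
  have hinj : Function.Injective fun k ↦ x k / b := by
    intro k l hkl
    have hkl' : x k = x l := (div_left_inj' hb0).mp hkl
    -- Equal abscissae mean equal or opposite points; either one makes a nonzero multiple of `P`
    -- vanish unless `k = l`.
    rcases (Point.X_eq_iff (h₁ := h k) (h₂ := h l)).mp hkl' with H | H
    · rw [← hx, ← hx] at H
      by_contra hne'
      wlog hlt : k < l generalizing k l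
      · exact this hkl.symm hkl'.symm H.symm (Ne.symm hne') (by omega)
      · refine hne (2 * (l - k)) (by omega) ?_
        have : (2 * l + 1) • P = (2 * k + 1) • P + (2 * (l - k)) • P := by
          rw [← add_nsmul]; congr 1; omega
        rw [this] at H
        exact left_eq_add.mp H
    · rw [← hx, ← hx, eq_neg_iff_add_eq_zero, ← add_nsmul] at H
      exact absurd H (hne _ (by omega))
  -- The values 1 and `b` are discarded because the triple needs distinct elements; `k = 0` does
  -- give `c = b`.
  refine ((Set.infinite_range_of_injective hinj).sdiff (Set.toFinite {1, b})).mono ?_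
  rintro _ ⟨⟨k, rfl⟩, hk⟩
  simp only [Set.mem_insert_iff, Set.mem_singleton_iff, not_or] at hk
  obtain ⟨t₁, t₂, t₃⟩ := hsq k
  refine isStrongRationalDTuple_of_isSquare hb1 hb0 hs₁ hs₂ hk.1 hk.2 ?_ ?_ ?_
  · convert! t₂.div (IsSquare.mul_self b) using 1; field_simp
  · convert! t₃.div (IsSquare.mul_self b) using 1; field_simp
  · rwa [mul_div_cancel₀ _ hb0]
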